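/- Theorem (Semiglobal practical stability under neural-operator approximation of the backstepping feedback law). \textbf{Setting.} For $a,b\in C^0[0,1]$ let $(a*b)(x)=\int_0^x a(x-y)b(y)\,dy$. For $\beta\in C^0[0,1]$ let $\mathcal K(\beta)\in C^0[0,1]$ be the unique solution $k$ of $k=-\beta+\beta*k$, and let $\mathcal U(\beta,u)=(\mathcal K(\beta)*u)(1)$ be the backstepping feedback law. Write $\|\cdot\|_\infty$ for the supremum norm and $\|\cdot\|$ for the $L^2[0,1]$ norm. Let $N$ be one of the two norms $\|\cdot\|_\infty$, $\|\cdot\|$ on $C^0[0,1]$; it measures the magnitude of the samples $u$ and of the initial data. Let $B_\beta,B_u,c>0$, and put $$\epsilon^*(B_\beta,B_u,c)=\frac{\sqrt c\,B_u}{e^{c/2}(1+B_\beta)},\qquad B_u^0(\epsilon,B_\beta,B_u,c)=\frac{1}{1+B_\beta e^{B_\beta}}\left(\frac{B_u}{e^{c/2}(1+B_\beta)}-\frac{\epsilon}{\sqrt c}\right).$$ \textbf{Claim.} One has $\epsilon^*>0$, and $B_u^0>0$ whenever $0<\epsilon<\epsilon^*$. Let $0<\epsilon<\epsilon^*$, and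 let $\hat{\mathcal U}:C^0[0,1]\times C^0[0,1]\to\mathbb R$ be any map (for instance a neural operator) that approximates $\mathcal U$ with accuracy $\epsilon$, i.e. $$|\mathcal U(\beta,u)-\hat{\mathcal U}(\beta,u)|<\epsilon\quad\text{for all Lipschitz }\beta,u\text{ with }\|\beta\|_\infty\le B_\beta,\ N(u)\le B_u .$$ Let $\beta$ be Lipschitz with $\|\beta\|_\infty\le B_\beta$, let $0<T\le\infty$, and let $u$ be a solution on $[0,T)$ of the closed loop $$u_t(x,t)=u_x(x,t)+\beta(x)u(0,t),\qquad u(1,t)=\hat{\mathcal U}(\beta,u(\cdot,t)),$$ that is continuous on $[0,1]\times[0,T)$ and Lipschitz in $x$ for each $t$; the equation is understood in integrated form along characteristics, $u(x-s,t+s)=u(x,t)+\int_0^s\beta(x-r)u(0,t+r)\,dr$ for $0\le s\le x\le 1$, and the boundary condition for $0<t<T$. If $N(u(\cdot,0))\le B_u^0$, then for all $t\in[0,T)$ (all $t\ge0$ when $T=\infty$) $$\|u(t)\|\le(1+B_\beta)(1+B_\beta e^{B_\beta})\,e^{c/2}e^{-ct/2}\,\|u(0)\|+(1+B_\beta)\frac{e^{c/2}}{\sqrt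 c}\,\epsilon .$$ -/

import Mathlib

namespace Backstepping

noncomputable section

open Set unitInterval

/-- The value at `x` of a function `f ∈ C⁰[0,1]`, for a real number `x ∈ [0,1]`
(outside `[0,1]` the function is continued by its boundary values; these values are never used). -/
def ev (f : C(I, ℝ)) : ℝ → ℝ := IccExtend (zero_le_one (α := ℝ)) f

lemma continuous_ev (f : C(I, ℝ)) : Continuous (ev f) := f.continuous.Icc_extend'

lemma abs_ev_le (f : C(I, ℝ)) (x : ℝ) : |ev f x| ≤ ‖f‖ := by
  simpa [ev, IccExtend] using f.norm_coe_le_norm (projIcc 0 1 zero_le_one x)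

lemma ev_coe (f : C(I, ℝ)) (x : I) : ev f x = f x := by
  simp [ev]

/-- The convolution `(a ∗ b)(x) = ∫₀ˣ a(x - y) b(y) dy`, `x ∈ [0,1]`. -/
def conv (a b : C(I, ℝ)) : C(I, ℝ) where
  toFun x := ∫ y in (0 : ℝ)..x, ev a (x - y) * ev b y
  continuous_toFun := by
    apply intervalIntegral.continuous_parametric_intervalIntegral_of_continuous
    · have ha := continuous_ev a
      have hb := continuous_ev b
      simp only [Function.uncurry_def]
      fun_prop
    · fun_prop

/-- One step of successive approximation for the equation `k = -β + β ∗ k`. -/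
def kernelStep (β k : C(I, ℝ)) : C(I, ℝ) := -β + conv β k

lemma conv_sub (a b c : C(I, ℝ)) : conv a b - conv a c = conv a (b - c) := by
  ext x
  have ha := continuous_ev a
  have hb := continuous_ev b
  have hc := continuous_ev c
  have h : ∀ y, ev (b - c) y = ev b y - ev c y := fun y => rfl
  simp only [conv, ContinuousMap.sub_apply, ContinuousMap.coe_mk, h, mul_sub]
  rw [intervalIntegral.integral_sub]
  · exact (Continuous.mul (by fun_prop) hb).intervalIntegrable _ _
  · exact (Continuous.mul (by fun_prop) hc).intervalIntegrable _ _

lemma iterate_bound (β k₁ k₂ : C(I, ℝ)) (n : ℕ) (x : I) :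
    |((kernelStep β)^[n] k₁ - (kernelStep β)^[n] k₂) x| ≤
      ‖β‖ ^ n * (x : ℝ) ^ n / n.factorial * ‖k₁ - k₂‖ := by
  induction n generalizing x with
  | zero => simpa using (k₁ - k₂).norm_coe_le_norm x
  | succ n ih =>
    set d := (kernelStep β)^[n] k₁ - (kernelStep β)^[n] k₂ with hd
    have h1 : (kernelStep β)^[n + 1] k₁ - (kernelStep β)^[n + 1] k₂ = conv β d := by
      rw [Function.iterate_succ_apply', Function.iterate_succ_apply', hd, ← conv_sub]
      simp [kernelStep]
    rw [h1]
    have hx0 : (0 : ℝ) ≤ x := x.2.1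
    have hx1 : (x : ℝ) ≤ 1 := x.2.2
    have hbound : ∀ y ∈ Ioc (0 : ℝ) x, ‖ev β (x - y) * ev d y‖ ≤
        ‖β‖ * (‖β‖ ^ n * y ^ n / n.factorial * ‖k₁ - k₂‖) := by
      intro y hy
      rw [norm_mul]
      have hyI : y ∈ I := ⟨hy.1.le, hy.2.trans hx1⟩
      have h2 : ev d y = d ⟨y, hyI⟩ := ev_coe d ⟨y, hyI⟩
      rw [h2]
      exact mul_le_mul (abs_ev_le _ _) (ih ⟨y, hyI⟩) (norm_nonneg _) (norm_nonneg _)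
    have h3 := intervalIntegral.norm_integral_le_of_norm_le (μ := MeasureTheory.volume) hx0
      (Filter.Eventually.of_forall hbound)
      (Continuous.intervalIntegrable (by fun_prop) _ _)
    have h4 : ∫ y in (0 : ℝ)..x, ‖β‖ * (‖β‖ ^ n * y ^ n / n.factorial * ‖k₁ - k₂‖) =
        ‖β‖ ^ (n + 1) * (x : ℝ) ^ (n + 1) / (n + 1).factorial * ‖k₁ - k₂‖ := by
      have : ∀ y : ℝ, ‖β‖ * (‖β‖ ^ n * y ^ n / n.factorial * ‖k₁ - k₂‖) =
          (‖β‖ ^ (n + 1) / n.factorial * ‖k₁ - k₂‖) * y ^ n := by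
        intro y; ring
      simp only [this]
      rw [intervalIntegral.integral_const_mul, integral_pow, Nat.factorial_succ]
      push_cast
      have : (n.factorial : ℝ) ≠ 0 := by positivity
      field_simp
      ring
    rw [h4] at h3
    exact h3

/-- The integral equation `k = -β + β ∗ k` has exactly one solution `k ∈ C⁰[0,1]`. -/
theorem existsUnique_kernel (β : C(I, ℝ)) : ∃! k : C(I, ℝ), k = -β + conv β k := by
  obtain ⟨n, hn⟩ : ∃ n : ℕ, ‖β‖ ^ n / n.factorial < 1 :=
    ((FloorSemiring.tendsto_pow_div_factorial_atTop ‖β‖).eventually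
      (gt_mem_nhds one_pos)).exists
  have hc : ContractingWith (Real.toNNReal (‖β‖ ^ n / n.factorial))
      (kernelStep β)^[n] := by
    refine ⟨by rwa [Real.toNNReal_lt_one], LipschitzWith.of_dist_le_mul fun k₁ k₂ => ?_⟩
    rw [Real.coe_toNNReal _ (by positivity), dist_eq_norm, dist_eq_norm,
      ContinuousMap.norm_le _ (by positivity)]
    intro x
    refine (iterate_bound β k₁ k₂ n x).trans ?_
    refine mul_le_mul_of_nonneg_right ?_ (norm_nonneg _)
    gcongr
    exact mul_le_of_le_one_right (by positivity) (pow_le_one₀ x.2.1 x.2.2)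
  refine ⟨hc.fixedPoint _, (hc.isFixedPt_fixedPoint_iterate).symm, fun k hk => ?_⟩
  have hk' : Function.IsFixedPt (kernelStep β) k := hk.symm
  exact hc.fixedPoint_unique (hk'.iterate n)

/-- The backstepping kernel operator `𝒦 : β ↦ k`, where `k = -β + β ∗ k`. -/
def kernelOp (β : C(I, ℝ)) : C(I, ℝ) := (existsUnique_kernel β).choose

theorem kernelOp_eq (β : C(I, ℝ)) : kernelOp β = -β + conv β (kernelOp β) :=
  (existsUnique_kernel β).choose_spec.1

/-- The backstepping feedback law `𝒰(β, u) = (𝒦(β) ∗ u)(1) = ∫₀¹ 𝒦(β)(1 - y) u(y) dy`. -/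
def feedback (β u : C(I, ℝ)) : ℝ := conv (kernelOp β) u 1

/-- The `L²[0,1]` norm of a continuous function. -/
def l2Norm (f : C(I, ℝ)) : ℝ := Real.sqrt (∫ x in (0 : ℝ)..1, ev f x ^ 2)

/-- `f` is Lipschitz continuous on `[0,1]`, with some constant. -/
def IsLip (f : C(I, ℝ)) : Prop := ∃ L : NNReal, LipschitzWith L f

/-- `Uhat` approximates the feedback map `𝒰` with accuracy `ε` at all Lipschitz `β`, `u` with
`‖β‖_∞ ≤ Bβ` and `N u ≤ Bu`. The norm `N` measures the size of the samples `u`. -/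
def IsAccurate (N : C(I, ℝ) → ℝ) (Uhat : C(I, ℝ) → C(I, ℝ) → ℝ) (ε Bβ Bu : ℝ) : Prop :=
  ∀ β u : C(I, ℝ), IsLip β → IsLip u → ‖β‖ ≤ Bβ → N u ≤ Bu →
    |feedback β u - Uhat β u| < ε

/-- `u` is a solution on the time interval `[0, T)`, `T ≤ ∞`, of the closed loop
`u_t(x,t) = u_x(x,t) + β(x) u(0,t)`, `u(1,t) = Uhat(β, u(·,t))`. Here `u t` is the profile
`x ↦ u(x,t)`. The equation holds in the sense of integration along the characteristic lines
`s ↦ (x - s, t + s)`, so that every continuously differentiable solution is included. -/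
structure IsClosedLoopSolution (Uhat : C(I, ℝ) → C(I, ℝ) → ℝ) (β : C(I, ℝ)) (T : EReal)
    (u : ℝ → C(I, ℝ)) : Prop where
  continuous_time : ContinuousOn u {t : ℝ | 0 ≤ t ∧ (t : EReal) < T}
  lipschitz_space : ∀ t : ℝ, 0 ≤ t → (t : EReal) < T → IsLip (u t)
  transport : ∀ t s x : ℝ, 0 ≤ t → 0 ≤ s → ((t + s : ℝ) : EReal) < T → s ≤ x → x ≤ 1 →
    ev (u (t + s)) (x - s) = ev (u t) x + ∫ r in (0 : ℝ)..s, ev β (x - r) * ev (u (t + r)) 0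
  boundary : ∀ t : ℝ, 0 < t → (t : EReal) < T → u t 1 = Uhat β (u t)

/-- `ε*(B_β, B_u, c) = √c B_u / (e^{c/2} (1 + B_β))`. -/
def epsStar (Bβ Bu c : ℝ) : ℝ := Real.sqrt c * Bu / (Real.exp (c / 2) * (1 + Bβ))

/-- `B_u⁰(ε, B_β, B_u, c)`, the radius of the ball of initial conditions. -/
def initRadius (ε Bβ Bu c : ℝ) : ℝ :=
  1 / (1 + Bβ * Real.exp Bβ) * (Bu / (Real.exp (c / 2) * (1 + Bβ)) - ε / Real.sqrt c)

/-- The semiglobal practical exponential stability estimate on the time interval `[0, T)`. -/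
def PracticalEstimate (ε Bβ c : ℝ) (T : EReal) (u : ℝ → C(I, ℝ)) : Prop :=
  ∀ t : ℝ, 0 ≤ t → (t : EReal) < T →
    l2Norm (u t) ≤
      (1 + Bβ) * (1 + Bβ * Real.exp Bβ) * Real.exp (c / 2) * Real.exp (-(c * t / 2)) *
          l2Norm (u 0)
        + (1 + Bβ) * (Real.exp (c / 2) / Real.sqrt c) * ε

end

end Backstepping

namespace Backstepping

open Set unitInterval MeasureTheory

/-! With `k = 𝒦(β)`, put `w = u - k ∗ u`. The kernel equation makes `w` constant along
characteristics (`transform_transport`), and `w(1,t)` equals `Uhat - 𝒰`, the error of the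
approximate feedback. So at time `t` the profile of `w` consists of shifted initial data, which has
left `[0,1]` by time 1, and of past errors. If the errors are at most `ε`, then `N(w(t)) ≤ N(w(0)) +
ε`, and the `L²` norm of `w(t)` is at most `ε` once `t ≥ 1`. Any decay rate `c` is therefore
available at the price of a factor `e^{c/2}`.

The inverse is `u = w - β ∗ w`, so passing between `u` and `w` costs the factors `1 + B_β e^{B_β}`
(`norm_kernelOp_le`) and `1 + B_β`. Accuracy is only known while `N(u) ≤ B_u`; the choice of `B_u⁰`
closes this circle by a continuity argument (`abs_transform_one_le`). -/

/-! ### Fubini on a truncated triangle and the algebra of convolution. -/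

theorem intervalIntegral_triangle_swap {F : ℝ → ℝ → ℝ} (hF : Continuous (Function.uncurry F))
    {s x : ℝ} (hs : 0 ≤ s) (hsx : s ≤ x) :
    ∫ z in (0 : ℝ)..x, ∫ r in (0 : ℝ)..min z s, F z r =
      ∫ r in (0 : ℝ)..s, ∫ z in r..x, F z r := by
  have hx : 0 ≤ x := hs.trans hsx
  let Φ : ℝ → ℝ → ℝ := fun z r => {p : ℝ × ℝ | p.2 ≤ p.1}.indicator (Function.uncurry F) (z, r)
  have hΦ : Integrable (Function.uncurry Φ)
      ((volume.restrict (Ioc 0 x)).prod (volume.restrict (Ioc 0 s))) := by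
    rw [Measure.prod_restrict]
    have h1 : IntegrableOn (Function.uncurry F) (Ioc 0 x ×ˢ Ioc 0 s) (volume.prod volume) :=
      (hF.continuousOn.integrableOn_compact (isCompact_Icc.prod isCompact_Icc)).mono_set
        (prod_mono Ioc_subset_Icc_self Ioc_subset_Icc_self)
    exact h1.indicator (measurableSet_le measurable_snd measurable_fst)
  have hz : ∀ z ∈ Ioc 0 x, ∫ r in (0 : ℝ)..min z s, F z r = ∫ r in Ioc 0 s, Φ z r := by
    intro z hz
    have h1 : ∀ r, Φ z r = (Iic z).indicator (F z) r := fun r => by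
      simp only [Φ, indicator_apply, mem_ofPred_eq, mem_Iic, Function.uncurry_apply_pair]
    simp only [h1]
    rw [setIntegral_indicator measurableSet_Iic, intervalIntegral.integral_of_le
      (le_min hz.1.le hs), Ioc_inter_Iic, min_comm]
  have hr : ∀ r ∈ Ioc 0 s, ∫ z in r..x, F z r = ∫ z in Ioc 0 x, Φ z r := by
    intro r hr
    have h1 : ∀ z, Φ z r = (Ici r).indicator (fun z => F z r) z := fun z => by
      simp only [Φ, indicator_apply, mem_ofPred_eq, mem_Ici, Function.uncurry_apply_pair]
    have h2 : Ioc 0 x ∩ Ici r = Icc r x := by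
      ext z
      simp only [mem_inter_iff, mem_Ioc, mem_Ici, mem_Icc]
      exact ⟨fun h => ⟨h.2, h.1.2⟩, fun h => ⟨⟨hr.1.trans_le h.1, h.2⟩, h.1⟩⟩
    simp only [h1]
    rw [setIntegral_indicator measurableSet_Ici, intervalIntegral.integral_of_le
      (hr.2.trans hsx), h2, integral_Icc_eq_integral_Ioc]
  rw [intervalIntegral.integral_of_le hx, intervalIntegral.integral_of_le hs,
    setIntegral_congr_fun measurableSet_Ioc hz, setIntegral_congr_fun measurableSet_Ioc hr]
  exact integral_integral_swap hΦ

/-- After the swap, the substitution `z = y + r` exposes `(a ∗ b)(x - r)`. The case `s = x` is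
associativity; `s < x` is needed along characteristics, where `g` is the trace `u(0, ·)`. -/
theorem integral_conv_truncated {a b g : ℝ → ℝ} (ha : Continuous a) (hb : Continuous b)
    (hg : Continuous g) {s x : ℝ} (hs : 0 ≤ s) (hsx : s ≤ x) :
    ∫ z in (0 : ℝ)..x, a (x - z) * ∫ r in (0 : ℝ)..min z s, b (z - r) * g r =
      ∫ r in (0 : ℝ)..s, (∫ y in (0 : ℝ)..x - r, a (x - r - y) * b y) * g r := by
  have h := intervalIntegral_triangle_swap
    (F := fun z r => a (x - z) * (b (z - r) * g r)) (by fun_prop) hs hsx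
  simp only [intervalIntegral.integral_const_mul] at h
  rw [h]
  refine intervalIntegral.integral_congr fun r _ => ?_
  have h1 := intervalIntegral.integral_comp_add_right (a := 0) (b := x - r)
    (fun z => a (x - z) * b (z - r)) r
  simp only [zero_add, sub_add_cancel, add_sub_cancel_right] at h1
  simp only [← mul_assoc, intervalIntegral.integral_mul_const]
  rw [← h1]
  congr 1
  refine intervalIntegral.integral_congr fun y _ => ?_
  simp only [show x - (y + r) = x - r - y by ring]

theorem ev_conv (a b : C(I, ℝ)) {x : ℝ} (h0 : 0 ≤ x) (h1 : x ≤ 1) :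
    ev (conv a b) x = ∫ y in (0 : ℝ)..x, ev a (x - y) * ev b y :=
  ev_coe (conv a b) ⟨x, h0, h1⟩

theorem conv_comm (a b : C(I, ℝ)) : conv a b = conv b a := by
  ext x
  have h := intervalIntegral.integral_comp_sub_left (a := 0) (b := x)
    (fun y => ev b (x - y) * ev a y) (x : ℝ)
  simp only [sub_sub_cancel, sub_self, sub_zero] at h
  change ∫ y in (0 : ℝ)..x, ev a (x - y) * ev b y = ∫ y in (0 : ℝ)..x, ev b (x - y) * ev a y
  rw [← h]
  exact intervalIntegral.integral_congr fun y _ => mul_comm _ _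

theorem conv_assoc (a b c : C(I, ℝ)) : conv a (conv b c) = conv (conv a b) c := by
  ext x
  have h := integral_conv_truncated (continuous_ev a) (continuous_ev b) (continuous_ev c)
    x.2.1 le_rfl
  change ∫ y in (0 : ℝ)..x, ev a (x - y) * ev (conv b c) y =
    ∫ y in (0 : ℝ)..x, ev (conv a b) (x - y) * ev c y
  have hl : ∀ z ∈ uIcc (0 : ℝ) x, ev a (x - z) * ev (conv b c) z =
      ev a (x - z) * ∫ r in (0 : ℝ)..min z x, ev b (z - r) * ev c r := by
    intro z hz
    rw [uIcc_of_le x.2.1] at hz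
    rw [ev_conv b c hz.1 (hz.2.trans x.2.2), min_eq_left hz.2]
  have hr : ∀ r ∈ uIcc (0 : ℝ) x, ev (conv a b) (x - r) * ev c r =
      (∫ y in (0 : ℝ)..x - r, ev a (x - r - y) * ev b y) * ev c r := by
    intro r hr
    rw [uIcc_of_le x.2.1] at hr
    rw [ev_conv a b (by linarith [hr.2]) (by linarith [hr.1, x.2.2])]
  rw [intervalIntegral.integral_congr hl, intervalIntegral.integral_congr hr, h]

/-! ### The backstepping transformation and its kernel. -/

/-- The backstepping transformation `u ↦ u - 𝒦(β) ∗ u`. -/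
noncomputable def transform (β u : C(I, ℝ)) : C(I, ℝ) := u - conv (kernelOp β) u

/-- Formally `(δ - k) ∗ (δ - β) = δ`; this one identity gives both the inverse transformation and
the cancellation in the transport equation. -/
theorem conv_kernelOp (β : C(I, ℝ)) : conv (kernelOp β) β = kernelOp β + β := by
  have h := kernelOp_eq β
  rw [conv_comm, add_comm]
  nth_rewrite 2 [h]
  abel

/-- The inverse of the backstepping transformation is `w ↦ w - β ∗ w`. -/
theorem transform_sub_conv (β u : C(I, ℝ)) :
    transform β u - conv β (transform β u) = u := by
  have h1 : conv (kernelOp β + β) u - conv β u = conv (kernelOp β) u := by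
    rw [conv_comm, conv_comm β, conv_sub, add_sub_cancel_right, conv_comm]
  rw [transform, ← conv_sub, conv_assoc, conv_comm β (kernelOp β), conv_kernelOp, ← h1]
  abel

theorem transform_apply_one (β u : C(I, ℝ)) : transform β u 1 = u 1 - feedback β u := rfl

/-- A weighted maximum replaces Gronwall: at a maximum point `x₀` of `|k| e^{-Bx}`, with value `M`,
the kernel equation gives `M e^{B x₀} ≤ B + M (e^{B x₀} - 1)`, hence `M ≤ B`. -/
theorem norm_kernelOp_le (β : C(I, ℝ)) : ‖kernelOp β‖ ≤ ‖β‖ * Real.exp ‖β‖ := by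
  set k := kernelOp β with hk
  set B := ‖β‖
  have hB : 0 ≤ B := norm_nonneg _
  obtain ⟨x₀, -, hx₀⟩ := (isCompact_univ (X := I)).exists_isMaxOn univ_nonempty
    (f := fun x : I => |k x| * Real.exp (-(B * x))) (by fun_prop)
  set M := |k x₀| * Real.exp (-(B * x₀)) with hM
  have hmax : ∀ x : I, |k x| ≤ M * Real.exp (B * x) := fun x => by
    have h : |k x| * Real.exp (-(B * x)) ≤ M := hx₀ (mem_univ x)
    rwa [Real.exp_neg, ← div_eq_mul_inv, div_le_iff₀ (Real.exp_pos _)] at h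
  have hM0 : 0 ≤ M := by positivity
  have hint : |conv β k x₀| ≤ M * (Real.exp (B * x₀) - 1) := by
    have hb : ∀ y ∈ Ioc (0 : ℝ) x₀, ‖ev β (x₀ - y) * ev k y‖ ≤ B * (M * Real.exp (B * y)) := by
      intro y hy
      have h2 : ev k y = k ⟨y, hy.1.le, hy.2.trans x₀.2.2⟩ := ev_coe k ⟨y, hy.1.le, hy.2.trans x₀.2.2⟩
      rw [norm_mul, h2]
      exact mul_le_mul (abs_ev_le _ _) (hmax _) (norm_nonneg _) hB
    have h3 := intervalIntegral.norm_integral_le_of_norm_le (μ := volume) x₀.2.1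
      (Filter.Eventually.of_forall hb) (Continuous.intervalIntegrable (by fun_prop) _ _)
    have h4 : ∫ y in (0 : ℝ)..x₀, B * (M * Real.exp (B * y)) =
        M * Real.exp (B * x₀) - M * Real.exp (B * 0) := by
      refine intervalIntegral.integral_eq_sub_of_hasDerivAt (f := fun y => M * Real.exp (B * y))
        (fun y _ => ?_) (Continuous.intervalIntegrable (by fun_prop) _ _)
      have := (((hasDerivAt_id y).const_mul B).exp.const_mul M)
      exact this.congr_deriv (by simp; ring)
    rw [h4] at h3
    refine h3.trans_eq ?_
    simp; ring
  have hMB : M ≤ B := by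
    have h1 : k x₀ = -β x₀ + conv β k x₀ := by
      have := kernelOp_eq β
      rw [← hk] at this
      nth_rewrite 1 [this]
      rfl
    have h2 : |k x₀| ≤ B + M * (Real.exp (B * x₀) - 1) := by
      rw [h1]
      refine (abs_add_le _ _).trans (add_le_add ?_ hint)
      rw [abs_neg]
      exact β.norm_coe_le_norm x₀
    have h3 : M * Real.exp (B * x₀) = |k x₀| := by
      rw [hM, mul_assoc, ← Real.exp_add]; simp
    linarith
  rw [ContinuousMap.norm_le _ (by positivity)]
  intro x
  refine (hmax x).trans (mul_le_mul hMB (Real.exp_le_exp.2 ?_) (Real.exp_nonneg _) hB)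
  exact mul_le_of_le_one_right hB x.2.2

/-! ### Bounds in the supremum and `L²` norms. -/

theorem conv_le_norm_mul_integral (a b : C(I, ℝ)) (x : I) :
    |conv a b x| ≤ ‖a‖ * ∫ y in (0 : ℝ)..1, |ev b y| := by
  have hb := continuous_ev b
  have h := intervalIntegral.norm_integral_le_of_norm_le (μ := volume) x.2.1
    (f := fun y => ev a (x - y) * ev b y) (g := fun y => ‖a‖ * |ev b y|)
    (Filter.Eventually.of_forall fun y _ => by
      rw [norm_mul]
      exact mul_le_mul_of_nonneg_right (abs_ev_le _ _) (norm_nonneg _))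
    (Continuous.intervalIntegrable (by fun_prop) _ _)
  refine h.trans ?_
  rw [intervalIntegral.integral_const_mul]
  refine mul_le_mul_of_nonneg_left ?_ (norm_nonneg _)
  exact intervalIntegral.integral_mono_interval le_rfl x.2.1 x.2.2
    (Filter.Eventually.of_forall fun y => abs_nonneg _) (hb.abs.intervalIntegrable _ _)

theorem l2Norm_nonneg (f : C(I, ℝ)) : 0 ≤ l2Norm f := Real.sqrt_nonneg _

theorem l2Norm_sq (f : C(I, ℝ)) : l2Norm f ^ 2 = ∫ x in (0 : ℝ)..1, ev f x ^ 2 :=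
  Real.sq_sqrt (intervalIntegral.integral_nonneg zero_le_one fun _ _ => sq_nonneg _)

theorem integral_abs_ev_le_l2Norm (f : C(I, ℝ)) : ∫ x in (0 : ℝ)..1, |ev f x| ≤ l2Norm f := by
  have hf := continuous_ev f
  set m := ∫ x in (0 : ℝ)..1, |ev f x| with hm
  -- The variance of `|f|` is nonnegative, `m` being its mean.
  have h : 0 ≤ ∫ x in (0 : ℝ)..1, (ev f x ^ 2 - 2 * m * |ev f x| + m ^ 2) :=
    intervalIntegral.integral_nonneg zero_le_one fun x _ => by
      rw [← sq_abs]; nlinarith [sq_nonneg (|ev f x| - m)]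
  rw [intervalIntegral.integral_add (Continuous.intervalIntegrable (by fun_prop) _ _)
    (Continuous.intervalIntegrable (by fun_prop) _ _), intervalIntegral.integral_sub
    (Continuous.intervalIntegrable (by fun_prop) _ _)
    (Continuous.intervalIntegrable (by fun_prop) _ _), intervalIntegral.integral_const_mul,
    ← l2Norm_sq, ← hm, intervalIntegral.integral_const] at h
  refine abs_le_of_sq_le_sq' ?_ (l2Norm_nonneg f) |>.2
  simp only [sub_zero, smul_eq_mul] at h
  linarith

/-- A constant `M` suffices as perturbation because convolutions are bounded uniformly in `x`; the
same form yields the continuity of `l2Norm`. -/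
theorem l2Norm_le_add {f a : C(I, ℝ)} {M : ℝ} (hM : 0 ≤ M) (h : ∀ x, |f x| ≤ |a x| + M) :
    l2Norm f ≤ l2Norm a + M := by
  have hf := continuous_ev f
  have ha := continuous_ev a
  refine (abs_le_of_sq_le_sq' ?_ (add_nonneg (l2Norm_nonneg a) hM)).2
  have h1 : l2Norm f ^ 2 ≤ ∫ x in (0 : ℝ)..1, (ev a x ^ 2 + 2 * M * |ev a x| + M ^ 2) := by
    rw [l2Norm_sq]
    refine intervalIntegral.integral_mono_on zero_le_one
      (Continuous.intervalIntegrable (by fun_prop) _ _)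
      (Continuous.intervalIntegrable (by fun_prop) _ _) fun x _ => ?_
    have hx : |ev f x| ≤ |ev a x| + M := h _
    rw [← sq_abs (ev f x), ← sq_abs (ev a x)]
    nlinarith [abs_nonneg (ev f x), abs_nonneg (ev a x)]
  rw [intervalIntegral.integral_add (Continuous.intervalIntegrable (by fun_prop) _ _)
    (Continuous.intervalIntegrable (by fun_prop) _ _), intervalIntegral.integral_add
    (Continuous.intervalIntegrable (by fun_prop) _ _)
    (Continuous.intervalIntegrable (by fun_prop) _ _), intervalIntegral.integral_const_mul,
    ← l2Norm_sq, intervalIntegral.integral_const] at h1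
  simp only [sub_zero, smul_eq_mul] at h1
  nlinarith [integral_abs_ev_le_l2Norm a]

theorem l2Norm_sub_conv_le (a u : C(I, ℝ)) {A : ℝ} (hA : ‖a‖ ≤ A) :
    l2Norm (u - conv a u) ≤ (1 + A) * l2Norm u := by
  have hu := l2Norm_nonneg u
  have hA0 : 0 ≤ A := (norm_nonneg _).trans hA
  rw [one_add_mul]
  refine l2Norm_le_add (by positivity) fun x => ?_
  refine (abs_sub _ _).trans (add_le_add_right ((conv_le_norm_mul_integral a u x).trans ?_) _)
  refine (mul_le_mul_of_nonneg_left (integral_abs_ev_le_l2Norm u) (norm_nonneg _)).trans ?_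
  gcongr

theorem norm_sub_conv_le (a u : C(I, ℝ)) {A : ℝ} (hA : ‖a‖ ≤ A) :
    ‖u - conv a u‖ ≤ (1 + A) * ‖u‖ := by
  have hA0 : 0 ≤ A := (norm_nonneg _).trans hA
  rw [ContinuousMap.norm_le _ (by positivity), one_add_mul]
  intro x
  refine (abs_sub _ _).trans (add_le_add (u.norm_coe_le_norm x)
    ((conv_le_norm_mul_integral a u x).trans ?_))
  have h : ∫ y in (0 : ℝ)..1, |ev u y| ≤ ∫ y in (0 : ℝ)..1, ‖u‖ :=
    intervalIntegral.integral_mono_on zero_le_one ((continuous_ev u).abs.intervalIntegrable _ _)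
      (by simp) fun y _ => abs_ev_le u y
  simp only [intervalIntegral.integral_const, sub_zero, one_smul] at h
  refine (mul_le_mul_of_nonneg_left h (norm_nonneg _)).trans ?_
  gcongr

theorem continuous_l2Norm : Continuous l2Norm := by
  refine (LipschitzWith.of_le_add fun f g => l2Norm_le_add dist_nonneg fun x => ?_).continuous
  have h : dist (f x) (g x) ≤ dist f g := ContinuousMap.dist_apply_le_dist x
  rw [Real.dist_eq] at h
  linarith [abs_sub_abs_le_abs_sub (f x) (g x)]

/-! ### Transport of the transformed solution. -/

section ClosedLoop

variable {Uhat : C(I, ℝ) → C(I, ℝ) → ℝ} {β : C(I, ℝ)} {T : EReal} {u : ℝ → C(I, ℝ)}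

/-- The transformed solution is constant along the characteristic lines. -/
theorem IsClosedLoopSolution.transform_transport (hu : IsClosedLoopSolution Uhat β T u)
    {t s x : ℝ} (ht : 0 ≤ t) (hs : 0 ≤ s) (hT : ((t + s : ℝ) : EReal) < T)
    (hsx : s ≤ x) (hx : x ≤ 1) :
    ev (transform β (u (t + s))) (x - s) = ev (transform β (u t)) x := by
  have hx0 : 0 ≤ x := hs.trans hsx
  have hβ := continuous_ev β
  have hk := continuous_ev (kernelOp β)
  have hut := continuous_ev (u t)
  have hus := continuous_ev (u (t + s))
  -- The trace `u(0, t + ·)` is known to be continuous only on `[0, s]`; `g` extends it to the line.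
  obtain ⟨g, hg, hgu⟩ : ∃ g : ℝ → ℝ, Continuous g ∧
      ∀ r ∈ Icc 0 s, g r = ev (u (t + r)) 0 := by
    refine ⟨IccExtend hs fun r : Icc 0 s => ev (u (t + r)) 0, ?_,
      fun r hr => IccExtend_of_mem hs _ hr⟩
    refine Continuous.Icc_extend' ?_
    have h1 : Continuous fun r : Icc 0 s => u (t + r) :=
      hu.continuous_time.comp_continuous (by fun_prop) fun r =>
        ⟨by linarith [r.2.1], (EReal.coe_le_coe_iff.2 (by linarith [r.2.2])).trans_lt hT⟩
    exact (continuous_eval_const (projIcc (0 : ℝ) 1 zero_le_one 0)).comp h1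
  have htr : ∀ q z : ℝ, 0 ≤ q → q ≤ s → q ≤ z → z ≤ 1 →
      ev (u (t + q)) (z - q) = ev (u t) z + ∫ r in (0 : ℝ)..q, ev β (z - r) * g r := by
    intro q z hq hqs hqz hz
    rw [hu.transport t q z ht hq
      ((EReal.coe_le_coe_iff.2 (by linarith)).trans_lt hT) hqz hz]
    congr 1
    refine intervalIntegral.integral_congr fun r hr => ?_
    rw [uIcc_of_le hq] at hr
    simp only [hgu r ⟨hr.1, hr.2.trans hqs⟩]
  have hcut := integral_conv_truncated hk hβ hg hs hsx
  -- By `k ∗ β = k + β` the double integral splits: the `k` part will cancel against `h2`, the `β`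
  -- part against the source term in `h4`.
  have hR : ∫ r in (0 : ℝ)..s, (∫ y in (0 : ℝ)..x - r, ev (kernelOp β) (x - r - y) * ev β y) * g r =
      (∫ r in (0 : ℝ)..s, ev (kernelOp β) (x - r) * g r) +
        ∫ r in (0 : ℝ)..s, ev β (x - r) * g r := by
    rw [← intervalIntegral.integral_add (Continuous.intervalIntegrable (by fun_prop) _ _)
      (Continuous.intervalIntegrable (by fun_prop) _ _)]
    refine intervalIntegral.integral_congr fun r hr => ?_
    rw [uIcc_of_le hs] at hr
    rw [← ev_conv (kernelOp β) β (by linarith [hr.2]) (by linarith [hr.1]), conv_kernelOp]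
    exact add_mul _ _ _
  have hJc : Continuous fun z => ∫ r in (0 : ℝ)..min z s, ev β (z - r) * g r := by
    refine intervalIntegral.continuous_parametric_intervalIntegral_of_continuous ?_ (by fun_prop)
    simp only [Function.uncurry_def]
    fun_prop
  set J : ℝ → ℝ := fun z => ∫ r in (0 : ℝ)..min z s, ev β (z - r) * g r
  have hii : ∀ {f : ℝ → ℝ} {a b : ℝ}, Continuous f → IntervalIntegrable f volume a b :=
    fun hf => hf.intervalIntegrable _ _
  -- the convolution with the profile at time `t + s`, moved to the interval `[s, x]`
  have h1 : ∫ y in (0 : ℝ)..x - s, ev (kernelOp β) (x - s - y) * ev (u (t + s)) y =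
      ∫ z in s..x, (ev (kernelOp β) (x - z) * ev (u t) z + ev (kernelOp β) (x - z) * J z) := by
    have h := intervalIntegral.integral_comp_sub_right (a := s) (b := x)
      (fun y => ev (kernelOp β) (x - s - y) * ev (u (t + s)) y) s
    rw [sub_self] at h
    rw [← h]
    refine intervalIntegral.integral_congr fun z hz => ?_
    rw [uIcc_of_le hsx] at hz
    simp only [J]
    rw [htr s z hs le_rfl hz.1 (hz.2.trans hx), min_eq_right hz.1, mul_add,
      show x - s - (z - s) = x - z by ring]
  -- For `z ≤ s` the characteristic starting at `z` reaches `x = 0` after time `z`, so `u(z,t) + J z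
  -- = g z`.
  have h2 : ∫ z in (0 : ℝ)..s, (ev (kernelOp β) (x - z) * ev (u t) z +
      ev (kernelOp β) (x - z) * J z) = ∫ z in (0 : ℝ)..s, ev (kernelOp β) (x - z) * g z := by
    refine intervalIntegral.integral_congr fun z hz => ?_
    rw [uIcc_of_le hs] at hz
    simp only [J]
    rw [min_eq_left hz.2, ← mul_add, ← htr z z hz.1 hz.2 le_rfl ((hz.2.trans hsx).trans hx),
      sub_self, hgu z hz]
  have h3 := intervalIntegral.integral_add_adjacent_intervals (a := 0) (b := s) (c := x)
    (μ := volume)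
    (f := fun z => ev (kernelOp β) (x - z) * ev (u t) z + ev (kernelOp β) (x - z) * J z)
    (hii (by fun_prop)) (hii (by fun_prop))
  rw [← h1, h2, intervalIntegral.integral_add (hii (by fun_prop)) (hii (by fun_prop)),
    hcut, hR] at h3
  have h4 := htr s x hs le_rfl hsx hx
  change ev (u (t + s)) (x - s) - ev (conv (kernelOp β) (u (t + s))) (x - s) =
    ev (u t) x - ev (conv (kernelOp β) (u t)) x
  rw [ev_conv _ _ (by linarith) (by linarith), ev_conv _ _ hx0 hx, h4]
  linarith

theorem IsClosedLoopSolution.transform_of_add_le (hu : IsClosedLoopSolution Uhat β T u)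
    {t x : ℝ} (ht : 0 ≤ t) (hT : (t : EReal) < T) (hx0 : 0 ≤ x) (hx : x + t ≤ 1) :
    ev (transform β (u t)) x = ev (transform β (u 0)) (x + t) := by
  have h := hu.transform_transport (t := 0) (s := t) (x := x + t) le_rfl ht (by simpa using hT)
    (by linarith) hx
  simpa using h

/-- The characteristic through `(x, t)` left the boundary `x = 1` at time `t + x - 1`. This time is
strictly positive, so the boundary condition is available there. -/
theorem IsClosedLoopSolution.transform_of_lt_add (hu : IsClosedLoopSolution Uhat β T u)
    {t x : ℝ} (hT : (t : EReal) < T) (hx0 : x ≤ 1) (hx : 1 < x + t) (h0 : 0 ≤ x) :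
    ev (transform β (u t)) x = transform β (u (t + x - 1)) 1 := by
  have h := hu.transform_transport (t := t + x - 1) (s := 1 - x) (x := 1) (by linarith)
    (by linarith) (by simpa using hT) (by linarith) le_rfl
  rw [show t + x - 1 + (1 - x) = t by ring, sub_sub_cancel] at h
  rw [h]
  exact ev_coe _ 1

theorem IsClosedLoopSolution.abs_transform_le_of_lt_add (hu : IsClosedLoopSolution Uhat β T u)
    {ε t x : ℝ} (hT : (t : EReal) < T)
    (hb : ∀ τ ∈ Ioc 0 t, |transform β (u τ) 1| ≤ ε) (h0 : 0 ≤ x) (hx0 : x ≤ 1)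
    (hx : 1 < x + t) : |ev (transform β (u t)) x| ≤ ε := by
  rw [hu.transform_of_lt_add hT hx0 hx h0]
  exact hb _ ⟨by linarith, by linarith⟩

theorem IsClosedLoopSolution.norm_transform_le (hu : IsClosedLoopSolution Uhat β T u)
    {ε t : ℝ} (hε : 0 ≤ ε) (ht : 0 ≤ t) (hT : (t : EReal) < T)
    (hb : ∀ τ ∈ Ioc 0 t, |transform β (u τ) 1| ≤ ε) :
    ‖transform β (u t)‖ ≤ ‖transform β (u 0)‖ + ε := by
  rw [ContinuousMap.norm_le _ (by positivity)]
  intro x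
  rw [← ev_coe, Real.norm_eq_abs]
  rcases le_or_gt ((x : ℝ) + t) 1 with h | h
  · rw [hu.transform_of_add_le ht hT x.2.1 h]
    linarith [abs_ev_le (transform β (u 0)) (x + t)]
  · linarith [hu.abs_transform_le_of_lt_add hT hb x.2.1 x.2.2 h, norm_nonneg (transform β (u 0))]

theorem IsClosedLoopSolution.l2Norm_transform_le_of_one_le
    (hu : IsClosedLoopSolution Uhat β T u) {ε t : ℝ} (hε : 0 ≤ ε) (ht : 1 ≤ t)
    (hT : (t : EReal) < T) (hb : ∀ τ ∈ Ioc 0 t, |transform β (u τ) 1| ≤ ε) :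
    l2Norm (transform β (u t)) ≤ ε := by
  have hw := continuous_ev (transform β (u t))
  refine (abs_le_of_sq_le_sq' ?_ hε).2
  rw [l2Norm_sq]
  have h : ∫ x in (0 : ℝ)..1, ev (transform β (u t)) x ^ 2 ≤ ∫ x in (0 : ℝ)..1, ε ^ 2 := by
    -- The open interval matters: at `t = 1`, `x = 0` the characteristic starts at time 0, where no
    -- boundary condition is imposed.
    refine intervalIntegral.integral_mono_on_of_le_Ioo zero_le_one
      (Continuous.intervalIntegrable (by fun_prop) _ _) (by simp) fun x hx => ?_
    exact sq_le_sq' (abs_le.1 (hu.abs_transform_le_of_lt_add hT hb hx.1.le hx.2.le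
      (by linarith [hx.1]))).1 (abs_le.1 (hu.abs_transform_le_of_lt_add hT hb hx.1.le hx.2.le
      (by linarith [hx.1]))).2
  simpa using h

theorem IsClosedLoopSolution.l2Norm_transform_le (hu : IsClosedLoopSolution Uhat β T u)
    {ε t : ℝ} (hε : 0 ≤ ε) (ht : 0 ≤ t) (hT : (t : EReal) < T)
    (hb : ∀ τ ∈ Ioc 0 t, |transform β (u τ) 1| ≤ ε) :
    l2Norm (transform β (u t)) ≤ l2Norm (transform β (u 0)) + ε := by
  rcases le_or_gt 1 t with h1 | h1
  · linarith [hu.l2Norm_transform_le_of_one_le hε h1 hT hb, l2Norm_nonneg (transform β (u 0))]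
  have hw := continuous_ev (transform β (u t))
  have hw0 := continuous_ev (transform β (u 0))
  have hn := l2Norm_nonneg (transform β (u 0))
  refine (abs_le_of_sq_le_sq' ?_ (by positivity)).2
  -- Left of `1 - t` the profile is shifted initial data, right of it boundary errors.
  rw [l2Norm_sq, ← intervalIntegral.integral_add_adjacent_intervals (b := 1 - t)
    (Continuous.intervalIntegrable (by fun_prop) _ _)
    (Continuous.intervalIntegrable (by fun_prop) _ _)]
  have h2 : ∫ x in (0 : ℝ)..1 - t, ev (transform β (u t)) x ^ 2 ≤
      l2Norm (transform β (u 0)) ^ 2 := by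
    have h3 : ∀ x ∈ uIcc 0 (1 - t), ev (transform β (u t)) x ^ 2 =
        ev (transform β (u 0)) (x + t) ^ 2 := fun x hx => by
      rw [uIcc_of_le (by linarith)] at hx
      rw [hu.transform_of_add_le ht hT hx.1 (by linarith [hx.2])]
    rw [intervalIntegral.integral_congr h3, l2Norm_sq,
      intervalIntegral.integral_comp_add_right (fun y => ev (transform β (u 0)) y ^ 2)]
    exact intervalIntegral.integral_mono_interval (by linarith) (by linarith) (by linarith)
      (Filter.Eventually.of_forall fun _ => sq_nonneg _)
      (Continuous.intervalIntegrable (by fun_prop) _ _)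
  have h4 : ∫ x in (1 - t)..1, ev (transform β (u t)) x ^ 2 ≤ ∫ x in (1 - t)..1, ε ^ 2 := by
    refine intervalIntegral.integral_mono_on_of_le_Ioo (by linarith)
      (Continuous.intervalIntegrable (by fun_prop) _ _) (by simp) fun x hx => ?_
    have h := abs_le.1 (hu.abs_transform_le_of_lt_add hT hb (by linarith [hx.1]) hx.2.le
      (by linarith [hx.1]))
    exact sq_le_sq' h.1 h.2
  rw [intervalIntegral.integral_const, sub_sub_cancel, smul_eq_mul] at h4
  have h5 : t * ε ^ 2 ≤ ε ^ 2 := mul_le_of_le_one_left (sq_nonneg _) h1.le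
  have h6 : 0 ≤ l2Norm (transform β (u 0)) * ε := mul_nonneg hn hε
  linarith [add_sq (l2Norm (transform β (u 0))) ε]

/-! ### The continuity argument and the final estimate. -/

/-- A continuous function that starts below the level `B` and is below `B` whenever it has not
exceeded `B` before stays below `B`. -/
theorem forall_lt_of_continuousOn_of_bootstrap {f : ℝ → ℝ} {B t : ℝ} (ht : 0 ≤ t)
    (hf : ContinuousOn f (Icc 0 t)) (h0 : f 0 < B)
    (h : ∀ s ∈ Icc 0 t, (∀ τ ∈ Ioc 0 s, f τ ≤ B) → f s < B) : f t < B := by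
  by_contra! hB
  obtain ⟨t₁, ht₁, hft₁⟩ := intermediate_value_Icc ht hf ⟨h0.le, hB⟩
  have hS : IsCompact (Icc 0 t ∩ f ⁻¹' {B}) :=
    isCompact_Icc.of_isClosed_subset (hf.preimage_isClosed_of_isClosed isClosed_Icc
      isClosed_singleton) inter_subset_left
  -- `τ` is the first time at level `B`; exceeding `B` before it would force an earlier crossing.
  obtain ⟨τ, ⟨hτ, hfτ⟩, hmin⟩ := hS.exists_isLeast ⟨t₁, ht₁, hft₁⟩
  refine (h τ hτ fun r hr => ?_).ne hfτ
  by_contra! hrB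
  have hrt : r ≤ t := hr.2.trans hτ.2
  obtain ⟨ρ, hρ, hfρ⟩ := intermediate_value_Icc hr.1.le
    (hf.mono (Icc_subset_Icc_right hrt)) ⟨h0.le, hrB.le⟩
  have hτρ : τ ≤ ρ := hmin ⟨⟨hρ.1, hρ.2.trans hrt⟩, hfρ⟩
  have hρr : ρ = r := le_antisymm hρ.2 (hr.2.trans hτρ)
  rw [hρr] at hfρ
  exact hrB.ne' hfρ

/-- The argument produces a plain `ε`; this inequality relaxes it to the stated `e^{c/2} ε / √c` and
supplies the strict inequality that the continuity argument needs. -/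
theorem sqrt_lt_exp_half {c : ℝ} (hc : 0 ≤ c) : Real.sqrt c < Real.exp (c / 2) := by
  nlinarith [Real.add_one_le_exp (c / 2), Real.sq_sqrt hc, sq_nonneg (Real.sqrt c - 1)]

/-- The boundary value of the transformed solution remains smaller than the accuracy. -/
theorem IsClosedLoopSolution.abs_transform_one_le (hu : IsClosedLoopSolution Uhat β T u)
    {N : C(I, ℝ) → ℝ} {ε Bβ Bu c : ℝ} (hBβ : 0 < Bβ) (hc : 0 < c) (hε : 0 < ε)
    (hβ : IsLip β) (hβB : ‖β‖ ≤ Bβ) (hacc : IsAccurate N Uhat ε Bβ Bu)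
    (hN0 : ∀ v, 0 ≤ N v) (hNc : Continuous N)
    (hN1 : ∀ v, N (transform β v) ≤ (1 + Bβ * Real.exp Bβ) * N v)
    (hN2 : ∀ v, N v ≤ (1 + Bβ) * N (transform β v))
    (hN3 : ∀ t : ℝ, 0 ≤ t → (t : EReal) < T → (∀ τ ∈ Ioc 0 t, |transform β (u τ) 1| ≤ ε) →
      N (transform β (u t)) ≤ N (transform β (u 0)) + ε)
    (hinit : N (u 0) ≤ initRadius ε Bβ Bu c) {t : ℝ} (ht : 0 < t) (hT : (t : EReal) < T) :
    |transform β (u t) 1| ≤ ε := by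
  have hlt : ∀ {s : ℝ}, s ≤ t → (s : EReal) < T := fun hs =>
    (EReal.coe_le_coe_iff.2 hs).trans_lt hT
  have hbd : ∀ τ ∈ Ioc 0 t, N (u τ) ≤ Bu → |transform β (u τ) 1| ≤ ε := by
    intro τ hτ hNτ
    have hτT := hlt hτ.2
    rw [transform_apply_one, hu.boundary τ hτ.1 hτT, abs_sub_comm]
    exact (hacc β (u τ) hβ (hu.lipschitz_space τ hτ.1.le hτT) hβB hNτ).le
  have hE1 : 1 < Real.exp (c / 2) := Real.one_lt_exp_iff.2 (by positivity)
  have hq0 : 0 < Real.sqrt c := Real.sqrt_pos.2 hc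
  have hK : 0 < 1 + Bβ * Real.exp Bβ := by positivity
  have hw0 : N (transform β (u 0)) + ε / Real.sqrt c ≤ Bu / (Real.exp (c / 2) * (1 + Bβ)) := by
    have h := (hN1 (u 0)).trans (mul_le_mul_of_nonneg_left hinit hK.le)
    rw [initRadius, ← mul_assoc, mul_one_div_cancel hK.ne', one_mul] at h
    linarith
  have hsmall : (1 + Bβ) * (N (transform β (u 0)) + ε) < Bu := by
    rw [le_div_iff₀ (by positivity)] at hw0
    have h1 : ε < Real.exp (c / 2) * (ε / Real.sqrt c) := by
      rw [mul_div_assoc', lt_div_iff₀ hq0, mul_comm]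
      exact mul_lt_mul_of_pos_right (sqrt_lt_exp_half hc.le) hε
    have h2 : N (transform β (u 0)) ≤ Real.exp (c / 2) * N (transform β (u 0)) :=
      le_mul_of_one_le_left (hN0 _) hE1.le
    calc (1 + Bβ) * (N (transform β (u 0)) + ε)
        < (1 + Bβ) * (Real.exp (c / 2) * N (transform β (u 0)) +
            Real.exp (c / 2) * (ε / Real.sqrt c)) :=
          mul_lt_mul_of_pos_left (by linarith) (by positivity)
      _ = (N (transform β (u 0)) + ε / Real.sqrt c) * (Real.exp (c / 2) * (1 + Bβ)) := by ring
      _ ≤ Bu := hw0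
  have hsub : ∀ s ∈ Icc 0 t, (∀ τ ∈ Ioc 0 s, N (u τ) ≤ Bu) → N (u s) < Bu := fun s hs hτ =>
    ((hN2 (u s)).trans (mul_le_mul_of_nonneg_left (hN3 s hs.1 (hlt hs.2) fun τ h =>
      hbd τ ⟨h.1, h.2.trans hs.2⟩ (hτ τ h)) (by positivity))).trans_lt hsmall
  -- At `s = 0` the hypothesis of `hsub` is vacuous, which gives the strict initial bound.
  refine hbd t ⟨ht, le_rfl⟩ (forall_lt_of_continuousOn_of_bootstrap (f := fun s => N (u s)) ht.le
    ?_ (hsub 0 ⟨le_rfl, ht.le⟩ (by simp)) hsub).le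
  exact hNc.comp_continuousOn (hu.continuous_time.mono fun s hs => ⟨hs.1, hlt hs.2⟩)

theorem norm_kernelOp_le_of_le {Bβ : ℝ} (hβ : ‖β‖ ≤ Bβ) :
    ‖kernelOp β‖ ≤ Bβ * Real.exp Bβ :=
  (norm_kernelOp_le β).trans
    (mul_le_mul hβ (Real.exp_le_exp.2 hβ) (Real.exp_nonneg _) ((norm_nonneg _).trans hβ))

/-- For `t < 1` the factor `e^{c/2} e^{-ct/2}` is at least 1, and for `t ≥ 1` the initial data no
longer contribute, so the exponential only has to be nonnegative. -/
theorem IsClosedLoopSolution.practicalEstimate (hu : IsClosedLoopSolution Uhat β T u)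
    {ε Bβ c : ℝ} (hc : 0 < c) (hε : 0 < ε) (hβB : ‖β‖ ≤ Bβ)
    (hb : ∀ t : ℝ, 0 < t → (t : EReal) < T → |transform β (u t) 1| ≤ ε) :
    PracticalEstimate ε Bβ c T u := by
  intro t ht hT
  have hBβ : 0 ≤ Bβ := (norm_nonneg _).trans hβB
  have hb' : ∀ τ ∈ Ioc 0 t, |transform β (u τ) 1| ≤ ε := fun τ hτ =>
    hb τ hτ.1 ((EReal.coe_le_coe_iff.2 hτ.2).trans_lt hT)
  have hn := l2Norm_nonneg (transform β (u 0))
  have hε' : ε ≤ Real.exp (c / 2) / Real.sqrt c * ε :=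
    le_mul_of_one_le_left hε.le
      ((one_le_div (Real.sqrt_pos.2 hc)).2 (sqrt_lt_exp_half hc.le).le)
  have hw : l2Norm (transform β (u t)) ≤ Real.exp (c / 2) * Real.exp (-(c * t / 2)) *
      l2Norm (transform β (u 0)) + Real.exp (c / 2) / Real.sqrt c * ε := by
    rcases le_or_gt 1 t with h1 | h1
    · have := hu.l2Norm_transform_le_of_one_le hε.le h1 hT hb'
      have : 0 ≤ Real.exp (c / 2) * Real.exp (-(c * t / 2)) * l2Norm (transform β (u 0)) := by
        positivity
      linarith
    · have := hu.l2Norm_transform_le hε.le ht hT hb'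
      have : l2Norm (transform β (u 0)) ≤
          Real.exp (c / 2) * Real.exp (-(c * t / 2)) * l2Norm (transform β (u 0)) := by
        refine le_mul_of_one_le_left hn ?_
        rw [← Real.exp_add]
        exact Real.one_le_exp (by nlinarith)
      linarith
  have hi : l2Norm (u t) ≤ (1 + Bβ) * l2Norm (transform β (u t)) := by
    have := l2Norm_sub_conv_le β (transform β (u t)) hβB
    rwa [transform_sub_conv] at this
  have h0 : l2Norm (transform β (u 0)) ≤ (1 + Bβ * Real.exp Bβ) * l2Norm (u 0) :=
    l2Norm_sub_conv_le _ _ (norm_kernelOp_le_of_le hβB)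
  calc l2Norm (u t) ≤ (1 + Bβ) * l2Norm (transform β (u t)) := hi
    _ ≤ (1 + Bβ) * (Real.exp (c / 2) * Real.exp (-(c * t / 2)) *
        ((1 + Bβ * Real.exp Bβ) * l2Norm (u 0)) + Real.exp (c / 2) / Real.sqrt c * ε) := by
      gcongr
      refine hw.trans ?_
      gcongr
    _ = _ := by ring

end ClosedLoop

/-! ### Positivity of the constants and the theorem. -/

theorem epsStar_pos {Bβ Bu c : ℝ} (hBβ : 0 < Bβ) (hBu : 0 < Bu) (hc : 0 < c) :
    0 < epsStar Bβ Bu c := by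
  unfold epsStar
  positivity

theorem initRadius_pos {ε Bβ Bu c : ℝ} (hBβ : 0 < Bβ) (hc : 0 < c)
    (hε : ε < epsStar Bβ Bu c) : 0 < initRadius ε Bβ Bu c := by
  refine mul_pos (by positivity) (sub_pos.2 ?_)
  rw [div_lt_iff₀ (Real.sqrt_pos.2 hc), mul_comm, mul_div_assoc']
  exact hε

end Backstepping

theorem mainTheorem2 (Bβ Bu c : ℝ) (hBβ : 0 < Bβ) (hBu : 0 < Bu) (hc : 0 < c) :
    0 < Backstepping.epsStar Bβ Bu c ∧
    ∀ ε : ℝ, 0 < ε → ε < Backstepping.epsStar Bβ Bu c →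
      0 < Backstepping.initRadius ε Bβ Bu c ∧
      ∀ (Uhat : C(unitInterval, ℝ) → C(unitInterval, ℝ) → ℝ) (β : C(unitInterval, ℝ))
        (T : EReal) (u : ℝ → C(unitInterval, ℝ)),
        Backstepping.IsLip β → ‖β‖ ≤ Bβ →
        Backstepping.IsClosedLoopSolution Uhat β T u →
          (Backstepping.IsAccurate (fun v => ‖v‖) Uhat ε Bβ Bu →
            ‖u 0‖ ≤ Backstepping.initRadius ε Bβ Bu c →
              Backstepping.PracticalEstimate ε Bβ c T u) ∧
          (Backstepping.IsAccurate Backstepping.l2Norm Uhat ε Bβ Bu →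
            Backstepping.l2Norm (u 0) ≤ Backstepping.initRadius ε Bβ Bu c →
              Backstepping.PracticalEstimate ε Bβ c T u) := by
  refine ⟨Backstepping.epsStar_pos hBβ hBu hc, fun ε hε hεs =>
    ⟨Backstepping.initRadius_pos hBβ hc hεs, fun Uhat β T u hβ hβB hu =>
      ⟨fun hacc hinit => ?_, fun hacc hinit => ?_⟩⟩⟩
  -- The final estimate is in `L²` in both cases; the choice of `N` only affects the proof that the
  -- samples stay in the ball where `Uhat` is accurate.
  · refine hu.practicalEstimate hc hε hβB fun t ht hT => ?_
    refine hu.abs_transform_one_le hBβ hc hε hβ hβB hacc (fun v => norm_nonneg v) continuous_norm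
      (fun v => Backstepping.norm_sub_conv_le _ _ (Backstepping.norm_kernelOp_le_of_le hβB))
      (fun v => ?_) (fun s hs hsT hb => hu.norm_transform_le hε.le hs hsT hb) hinit ht hT
    have := Backstepping.norm_sub_conv_le β (Backstepping.transform β v) hβB
    rwa [Backstepping.transform_sub_conv] at this
  · refine hu.practicalEstimate hc hε hβB fun t ht hT => ?_
    refine hu.abs_transform_one_le hBβ hc hε hβ hβB hacc Backstepping.l2Norm_nonneg
      Backstepping.continuous_l2Norm
      (fun v => Backstepping.l2Norm_sub_conv_le _ _ (Backstepping.norm_kernelOp_le_of_le hβB))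
      (fun v => ?_) (fun s hs hsT hb => hu.l2Norm_transform_le hε.le hs hsT hb) hinit ht hT
    have := Backstepping.l2Norm_sub_conv_le β (Backstepping.transform β v) hβB
    rwa [Backstepping.transform_sub_conv] at this
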